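/- **Theorem 2.** Let $R>0$, $\theta\in(0,1)$, and let $f$ be holomorphic in $|z|<R$ with $f(z)\neq 0$ and $f(z)\ne 1$ for all $|z|<R$. (a) For every $z$ with $|z|\le\theta R$, $$|f(z)|\le \exp\bigl(\pi e^{2|w|}\bigr)$$ for every value $w$ (for all choices of the branches of the logarithms and of the square root) of $$\tfrac12\ln\Bigl[1+2\sqrt{\tfrac{\ln f(z)}{2\pi i}\Bigl(1-\tfrac{\ln f(z)}{2\pi i}\Bigr)}\Bigr].$$ (b) There are holomorphic branches in $|z|<R$ of $$F(z)=\tfrac12\ln\Bigl[2h(z)-1+2\sqrt{h(z)\,(h(z)-1)}\Bigr],\qquad h(z)=\frac{\ln f(z)}{2\pi i},$$ and for every such holomorphic $F$ (with any holomorphic branches of $\ln f$ and of the square root) and every $z$ with $|z|\le\theta R$, $$|f(z)|\le S_f=\exp\bigl(\pi e^{2|F(z)|}\bigr)\qquad\text{and}\qquad |F(z)|\le|F(0)|+\frac dB\ln\frac1{1-\theta}.$$ Here $B$ is Bloch's constant (the supremum of all $b$ such that every holomorphic $g$ on the unit disc with $g'(0)=1$ maps some open subset of the unit disc bijectively onto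 an open disc of radius $b$), and $d$ is the supremum of the radii of the open discs in $\mathbb C$ that contain no point of $E=\{\pm\ln(\sqrt n-\sqrt{n-1})+2m\pi i : n\ge 1,\ m\in\mathbb Z\}$. -/

import Mathlib

/-- `F` is an analytic function on the disc `|z| < R` given by
`F = ½ ln [2 h - 1 + 2 √(h (h - 1))]` with `h = (ln f) / (2 π i)`, where `ℓ` is the branch of
`ln f` used, `s` the branch of the square root, and `F` half of a branch of the outer logarithm. -/
def IsSchottkyFunction (f : ℂ → ℂ) (R : ℝ) (F : ℂ → ℂ) : Prop :=
  ∃ ℓ s : ℂ → ℂ,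
    DifferentiableOn ℂ ℓ (Metric.ball 0 R) ∧
    DifferentiableOn ℂ s (Metric.ball 0 R) ∧
    DifferentiableOn ℂ F (Metric.ball 0 R) ∧
    ∀ z ∈ Metric.ball (0 : ℂ) R,
      Complex.exp (ℓ z) = f z ∧
      s z ^ 2 = ℓ z / (2 * Real.pi * Complex.I) * (ℓ z / (2 * Real.pi * Complex.I) - 1) ∧
      Complex.exp (2 * F z) = 2 * (ℓ z / (2 * Real.pi * Complex.I)) - 1 + 2 * s z

/-- `w` is one of the values of the multivalued expression
`½ ln [1 + 2 √((ln a / (2 π i)) (1 - ln a / (2 π i)))]`. -/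
def IsSchottkyValue (a w : ℂ) : Prop :=
  ∃ ℓ s : ℂ,
    Complex.exp ℓ = a ∧
    s ^ 2 = ℓ / (2 * Real.pi * Complex.I) * (1 - ℓ / (2 * Real.pi * Complex.I)) ∧
    Complex.exp (2 * w) = 1 + 2 * s

/-- The set of the points `± ln (√n - √(n - 1)) + 2 m π i` with `n ≥ 1` and `m ∈ ℤ`. -/
def exceptionalSet : Set ℂ :=
  {w | ∃ (n : ℕ) (m : ℤ), 1 ≤ n ∧
    (w = ((Real.log (√(n : ℝ) - √((n : ℝ) - 1)) : ℝ) : ℂ) + 2 * m * Real.pi * Complex.I ∨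
     w = -((Real.log (√(n : ℝ) - √((n : ℝ) - 1)) : ℝ) : ℂ) + 2 * m * Real.pi * Complex.I)}

/-- The constant `d`: the supremum of the radii of the open discs that avoid `exceptionalSet`. -/
noncomputable def discGap : ℝ :=
  sSup {r : ℝ | ∃ c : ℂ, Disjoint (Metric.ball c r) exceptionalSet}

/-- Bloch's constant `B`: the supremum of all `b` such that every holomorphic `g` on the unit disc
with `g' 0 = 1` maps some open subset of the unit disc bijectively onto an open disc of
radius `b`. -/
noncomputable def blochConstant : ℝ :=
  sSup {b : ℝ | ∀ g : ℂ → ℂ, DifferentiableOn ℂ g (Metric.ball 0 1) → deriv g 0 = 1 →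
    ∃ (c : ℂ) (U : Set ℂ), IsOpen U ∧ U ⊆ Metric.ball 0 1 ∧ Set.BijOn g U (Metric.ball c b)}

/-! With `h = ln f / (2πi)` one has `|f| = exp (-2π Im h)`, so `|f|` is controlled by `2 |Im h|`.
The function `F` is built so that `cosh (2F) = 2h - 1`, hence `2 |Im h| ≤ |cosh (2F)| ≤ e^{2|F|}`.
For the other root, `1 - 2h` and `2s` have squares summing to `1`, which gives `2 |Im h| ≤ |Re
(e^{2w}) - 1| ≤ e^{2|w|}`; this is pointwise and needs no holomorphic branch.

On `exceptionalSet`, `cosh (2w)` has the form `2n - 1`. A value of `F` there would make `h` an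
integer and `f = 1`, so `F` omits the set and its image contains no disc of radius larger than `d`.
Bloch's theorem, rescaled to the disc about `z` of radius `R - |z|`, then gives `|F'(z)| (R - |z|) ≤
d / B`, and integration along a radius gives the logarithmic bound.

Both constants are real suprema, so they have content only once their sets are shown to be bounded;
dividing by `B` also needs `B > 0`. -/

/-! ### Bloch's theorem and positivity of `B` -/

/-- A holomorphic map whose derivative varies by at most half of its value at the center of a disc
maps an open subset of the disc bijectively onto an explicit disc. -/
theorem exists_bijOn_ball_of_norm_deriv_sub_le {g : ℂ → ℂ} {a : ℂ} {r : ℝ} (hr : 0 < r)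
    (hg : DifferentiableOn ℂ g (Metric.ball a r)) (ha : deriv g a ≠ 0)
    (h : ∀ z ∈ Metric.ball a r, ‖deriv g z - deriv g a‖ ≤ ‖deriv g a‖ / 2)
    {ρ : ℝ} (hρ : ρ ≤ ‖deriv g a‖ * r / 4) :
    ∃ U : Set ℂ, IsOpen U ∧ U ⊆ Metric.ball a r ∧ Set.BijOn g U (Metric.ball (g a) ρ) := by
  have key : ∀ x ∈ Metric.ball a r, ∀ y ∈ Metric.ball a r,
      ‖g y - g x - (y - x) * deriv g a‖ ≤ ‖deriv g a‖ / 2 * ‖y - x‖ := by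
    intro x hx y hy
    have := (convex_ball a r).norm_image_sub_le_of_norm_hasDerivWithin_le
      (f := fun z => g z - z * deriv g a) (f' := fun z => deriv g z - 1 * deriv g a)
      (C := ‖deriv g a‖ / 2) (fun z hz => by
        have hd := (hg.differentiableAt (Metric.isOpen_ball.mem_nhds hz)).hasDerivAt
        exact (hd.sub ((hasDerivAt_id z).mul_const (deriv g a))).hasDerivWithinAt)
      (fun z hz => by simpa using h z hz) hx hy
    have e : g y - y * deriv g a - (g x - x * deriv g a) = g y - g x - (y - x) * deriv g a := by
      ring
    rwa [e] at this
  have hm : 0 < ‖deriv g a‖ := norm_pos_iff.2 ha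
  have approx : ApproximatesLinearOn g (ContinuousLinearMap.toSpanSingleton ℂ (deriv g a))
      (Metric.ball a r) (‖deriv g a‖₊ / 2) := by
    intro x hx y hy
    simpa using key y hy x hx
  let inv : (ContinuousLinearMap.toSpanSingleton ℂ (deriv g a)).NonlinearRightInverse :=
    { toFun := fun y => y / deriv g a
      nnnorm := ‖deriv g a‖₊⁻¹
      bound' := fun y => by simp [div_eq_inv_mul]
      right_inv' := fun y => by simp [ha] }
  -- The image covers radius `(‖g' a‖ - ‖g' a‖ / 2) * (r / 2) = ‖g' a‖ * r / 4`; the half radius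
  -- keeps the closed disc inside the open one.
  have surj := approx.surjOn_closedBall_of_nonlinearRightInverse inv (ε := r / 2) (b := a)
    (by positivity) (Metric.closedBall_subset_ball (by linarith))
  have inj : Set.InjOn g (Metric.ball a r) := by
    intro x hx y hy hxy
    by_contra hne
    have h1 := key x hx y hy
    rw [hxy, sub_self, zero_sub, norm_neg, norm_mul] at h1
    have h2 : 0 < ‖y - x‖ := norm_pos_iff.2 (sub_ne_zero.2 (Ne.symm hne))
    nlinarith [mul_pos h2 hm]
  refine ⟨Metric.ball a r ∩ g ⁻¹' Metric.ball (g a) ρ,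
    hg.continuousOn.isOpen_inter_preimage Metric.isOpen_ball Metric.isOpen_ball,
    Set.inter_subset_left, fun z hz => hz.2, inj.mono Set.inter_subset_left, ?_⟩
  intro y hy
  obtain ⟨x, hx, rfl⟩ := surj (a := y) (by
    refine Metric.ball_subset_closedBall (Metric.ball_subset_ball ?_ hy)
    have : (((inv.nnnorm : NNReal) : ℝ)⁻¹ - ((‖deriv g a‖₊ / 2 : NNReal) : ℝ)) * (r / 2)
        = ‖deriv g a‖ * r / 4 := by
      simp only [inv]
      push_cast
      rw [inv_inv]
      ring
    rw [this]
    exact hρ)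
  exact ⟨x, ⟨Metric.closedBall_subset_ball (by linarith) hx, hy⟩, rfl⟩

/-- **Bloch's theorem**, with the constant `1 / 96`. -/
theorem bloch_theorem {g : ℂ → ℂ} (hg : DifferentiableOn ℂ g (Metric.ball 0 1))
    (h1 : deriv g 0 = 1) :
    ∃ (c : ℂ) (U : Set ℂ), IsOpen U ∧ U ⊆ Metric.ball 0 1 ∧
      Set.BijOn g U (Metric.ball c (1 / 96)) := by
  have hg' : DifferentiableOn ℂ (deriv g) (Metric.ball 0 1) := hg.deriv Metric.isOpen_ball
  have hsub : Metric.closedBall (0 : ℂ) (1 / 2) ⊆ Metric.ball 0 1 :=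
    Metric.closedBall_subset_ball (by norm_num)
  -- The derivative may be unbounded near the unit circle, so the weighted maximum is taken on the
  -- half disc. It is at least its value `1 / 2` at the origin.
  obtain ⟨a, ha, hmax⟩ := (isCompact_closedBall (0 : ℂ) (1 / 2)).exists_isMaxOn
    (f := fun z => (1 / 2 - ‖z‖) * ‖deriv g z‖) ⟨0, by simp⟩
    ((by fun_prop : Continuous fun z : ℂ => 1 / 2 - ‖z‖).continuousOn.mul
      (hg'.continuousOn.mono hsub).norm)
  have hmax' : ∀ z : ℂ, ‖z‖ ≤ 1 / 2 →
      (1 / 2 - ‖z‖) * ‖deriv g z‖ ≤ (1 / 2 - ‖a‖) * ‖deriv g a‖ := fun z hz =>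
    hmax (by simpa using hz)
  have hM : 1 / 2 ≤ (1 / 2 - ‖a‖) * ‖deriv g a‖ := by simpa [h1] using hmax' 0 (by simp)
  have ha' : ‖a‖ ≤ 1 / 2 := by simpa using ha
  -- Half the distance from `a` to the circle of radius `1 / 2`: within `ρ` of `a` the weight at
  -- least halves at worst, so `‖g'‖ ≤ 2 ‖g' a‖`.
  obtain ⟨ρ, hρ⟩ : ∃ ρ, ρ = (1 / 2 - ‖a‖) / 2 := ⟨_, rfl⟩
  have ha2 : ‖a‖ = 1 / 2 - 2 * ρ := by linarith
  have hMρ : 1 / 4 ≤ ρ * ‖deriv g a‖ := by rw [ha2] at hM; linarith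
  have hm0 : 0 ≤ ‖deriv g a‖ := norm_nonneg _
  have hρ0 : 0 < ρ := by
    by_contra hcon
    nlinarith
  have hm : 0 < ‖deriv g a‖ := by
    by_contra hcon
    nlinarith
  have hnorm : ∀ z ∈ Metric.ball a ρ, ‖z‖ ≤ 1 / 2 - ρ := by
    intro z hz
    have := norm_le_norm_add_norm_sub' z a
    rw [mem_ball_iff_norm] at hz
    linarith
  have hball : Metric.ball a ρ ⊆ Metric.ball 0 1 := fun z hz => by
    have := hnorm z hz
    rw [mem_ball_zero_iff]
    linarith
  have hbound : ∀ z ∈ Metric.ball a ρ, ‖deriv g z‖ ≤ 2 * ‖deriv g a‖ := by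
    intro z hz
    have hz1 := hnorm z hz
    have h2 := hmax' z (by linarith)
    have h3 : ρ * ‖deriv g z‖ ≤ (1 / 2 - ‖z‖) * ‖deriv g z‖ :=
      mul_le_mul_of_nonneg_right (by linarith) (norm_nonneg _)
    have h4 : ρ * ‖deriv g z‖ ≤ ρ * (2 * ‖deriv g a‖) := by
      rw [ha2] at h2
      linarith
    exact le_of_mul_le_mul_left h4 hρ0
  -- Schwarz's lemma for `g' - g' a`, bounded by `3 ‖g' a‖`; the factor `1 / 6` brings this down to
  -- `‖g' a‖ / 2`. The covered radius is then `‖g' a‖ * (ρ / 6) / 4 ≥ 1 / 96`.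
  have hschwarz : ∀ z ∈ Metric.ball a (ρ / 6), ‖deriv g z - deriv g a‖ ≤ ‖deriv g a‖ / 2 := by
    intro z hz
    have hzρ : z ∈ Metric.ball a ρ := Metric.ball_subset_ball (by linarith) hz
    have h2 := Complex.dist_le_div_mul_dist_of_mapsTo_ball (R₂ := 3 * ‖deriv g a‖)
      (hg'.mono hball) (fun w hw => by
        rw [mem_closedBall_iff_norm]
        have := norm_sub_le (deriv g w) (deriv g a)
        have := hbound w hw
        linarith) hzρ
    rw [← dist_eq_norm]
    refine h2.trans ?_
    have h3 : dist z a ≤ ρ / 6 := (Metric.mem_ball.1 hz).le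
    calc 3 * ‖deriv g a‖ / ρ * dist z a ≤ 3 * ‖deriv g a‖ / ρ * (ρ / 6) := by gcongr
      _ = ‖deriv g a‖ / 2 := by field_simp; ring
  obtain ⟨U, hU, hUs, hbij⟩ := exists_bijOn_ball_of_norm_deriv_sub_le (r := ρ / 6) (ρ := 1 / 96)
    (by positivity) (hg.mono ((Metric.ball_subset_ball (by linarith)).trans hball))
    (norm_pos_iff.1 hm) hschwarz (by linarith)
  exact ⟨g a, U, hU, hUs.trans ((Metric.ball_subset_ball (by linarith)).trans hball), hbij⟩

/-- The identity map is the test function: its image stays in the unit disc. -/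
theorem bddAbove_blochConstant_set :
    BddAbove {b : ℝ | ∀ g : ℂ → ℂ, DifferentiableOn ℂ g (Metric.ball 0 1) → deriv g 0 = 1 →
      ∃ (c : ℂ) (U : Set ℂ), IsOpen U ∧ U ⊆ Metric.ball 0 1 ∧
        Set.BijOn g U (Metric.ball c b)} := by
  refine ⟨2, fun b hb => ?_⟩
  obtain ⟨c, U, -, hU, hbij⟩ := hb id differentiableOn_id (by simp)
  have hsub : Metric.ball c b ⊆ Metric.ball 0 1 := by
    rw [← hbij.image_eq]
    simpa using hU
  by_contra! hb2
  have h1 : ‖c + 1‖ < 1 := by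
    simpa using hsub (show c + 1 ∈ Metric.ball c b by simp; linarith)
  have h2 : ‖c - 1‖ < 1 := by
    simpa using hsub (show c - 1 ∈ Metric.ball c b by simp; linarith)
  have h3 := norm_sub_le (c + 1) (c - 1)
  have : (c + 1) - (c - 1) = 2 := by ring
  rw [this] at h3
  norm_num at h3
  linarith

theorem blochConstant_pos : 0 < blochConstant :=
  lt_of_lt_of_le (by norm_num : (0 : ℝ) < 1 / 96)
    (le_csSup bddAbove_blochConstant_set fun _ hg h1 => bloch_theorem hg h1)

/-! ### Holomorphic logarithms -/

/-- A nowhere vanishing holomorphic function on a disc has a holomorphic logarithm. -/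
theorem exists_holomorphic_log {f : ℂ → ℂ} {c : ℂ} {r : ℝ}
    (hf : DifferentiableOn ℂ f (Metric.ball c r)) (h0 : ∀ z ∈ Metric.ball c r, f z ≠ 0) :
    ∃ ℓ : ℂ → ℂ, DifferentiableOn ℂ ℓ (Metric.ball c r) ∧
      ∀ z ∈ Metric.ball c r, Complex.exp (ℓ z) = f z := by
  -- A primitive of `f' / f`, normalised at the center.
  obtain ⟨ℓ, hℓc, hℓ⟩ := ((hf.deriv Metric.isOpen_ball).div hf h0).isExactOn_ball.with_val_at c
    (Complex.log (f c))
  refine ⟨ℓ, fun z hz => (hℓ z hz).differentiableAt.differentiableWithinAt, fun z hz => ?_⟩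
  have hc : c ∈ Metric.ball c r := Metric.mem_ball_self (dist_nonneg.trans_lt hz)
  have hder : ∀ x ∈ Metric.ball c r, HasDerivAt (fun z => Complex.exp (ℓ z) / f z) 0 x := by
    intro x hx
    have hd := (hf.differentiableAt (Metric.isOpen_ball.mem_nhds hx)).hasDerivAt
    have hne := h0 x hx
    refine ((hℓ x hx).cexp.div hd hne).congr_deriv ?_
    rw [Pi.div_apply]
    field_simp
    ring
  have := Metric.isOpen_ball.is_const_of_deriv_eq_zero (convex_ball c r).isPreconnected
    (fun x hx => (hder x hx).differentiableAt.differentiableWithinAt)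
    (fun x hx => (hder x hx).deriv) hz hc
  simp only [hℓc, Complex.exp_log (h0 c hc), div_self (h0 c hc)] at this
  exact (div_eq_one_iff_eq (h0 z hz)).1 this

/-! ### Finiteness of `d` -/

/-- Since `-log (√n - √(n - 1)) = log (√n + √(n - 1))` grows like half of `log n`, taking `n` near
`e^{2 |Re c|}` matches the real part within `2`, and rounding to a multiple of `2π` matches the
imaginary part within `π < 4`. -/
theorem exists_mem_exceptionalSet_norm_sub_le (c : ℂ) : ∃ e ∈ exceptionalSet, ‖e - c‖ ≤ 6 := by
  obtain ⟨n, hn⟩ : ∃ n, n = ⌈Real.exp (2 * |c.re|)⌉₊ := ⟨_, rfl⟩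
  obtain ⟨m, hm⟩ : ∃ m, m = round (c.im / (2 * Real.pi)) := ⟨_, rfl⟩
  have hpi := Real.pi_pos
  have hlow : Real.exp (2 * |c.re|) ≤ n := hn ▸ Nat.le_ceil _
  have hup : (n : ℝ) < Real.exp (2 * |c.re|) + 1 := hn ▸ Nat.ceil_lt_add_one (Real.exp_nonneg _)
  have hone : 1 ≤ Real.exp (2 * |c.re|) := Real.one_le_exp (by positivity)
  have hn1 : (1 : ℝ) ≤ n := hone.trans hlow
  have htwo : 2 ≤ Real.exp 1 := by
    have := Real.add_one_le_exp (1 : ℝ)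
    linarith
  have hs1 : Real.exp |c.re| ≤ √(n : ℝ) := by
    refine Real.le_sqrt_of_sq_le ?_
    rwa [← Real.exp_nat_mul, Nat.cast_ofNat]
  have hs2 : √(n : ℝ) ≤ Real.exp (|c.re| + 1) := by
    refine (Real.sqrt_le_left (Real.exp_nonneg _)).2 ?_
    rw [← Real.exp_nat_mul, Nat.cast_ofNat, mul_add, Real.exp_add]
    have : Real.exp 1 ≤ Real.exp (2 * 1) := Real.exp_le_exp.2 (by norm_num)
    nlinarith
  have hsn : √((n : ℝ) - 1) ≤ √(n : ℝ) := Real.sqrt_le_sqrt (by linarith)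
  have hprod : (√(n : ℝ) - √((n : ℝ) - 1)) = (√(n : ℝ) + √((n : ℝ) - 1))⁻¹ := by
    have h1 := Real.sq_sqrt (by linarith : (0 : ℝ) ≤ n)
    have h2 := Real.sq_sqrt (by linarith : (0 : ℝ) ≤ (n : ℝ) - 1)
    refine eq_inv_of_mul_eq_one_left ?_
    linear_combination h1 - h2
  have hlog : |Real.log (√(n : ℝ) - √((n : ℝ) - 1)) + (|c.re|)| ≤ 2 := by
    have h0 : 0 < √(n : ℝ) + √((n : ℝ) - 1) := by positivity
    have h1 : |c.re| ≤ Real.log (√(n : ℝ) + √((n : ℝ) - 1)) := by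
      rw [Real.le_log_iff_exp_le h0]
      linarith [Real.sqrt_nonneg ((n : ℝ) - 1)]
    have h2 : Real.log (√(n : ℝ) + √((n : ℝ) - 1)) ≤ |c.re| + 2 := by
      rw [Real.log_le_iff_le_exp h0, show |c.re| + 2 = |c.re| + 1 + 1 by ring, Real.exp_add]
      nlinarith [Real.exp_pos (|c.re| + 1)]
    rw [hprod, Real.log_inv, abs_le]
    constructor <;> linarith
  have him : |2 * m * Real.pi - c.im| ≤ 4 := by
    have h1 := abs_sub_round (c.im / (2 * Real.pi))
    have h2 : 2 * m * Real.pi - c.im = -(c.im / (2 * Real.pi) - m) * (2 * Real.pi) := by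
      field_simp
      ring
    rw [h2, abs_mul, abs_neg, abs_of_pos (by positivity : 0 < 2 * Real.pi), hm]
    nlinarith [Real.pi_lt_four]
  obtain ⟨e, he⟩ : ∃ e : ℝ, (e = Real.log (√(n : ℝ) - √((n : ℝ) - 1)) ∨
      e = -Real.log (√(n : ℝ) - √((n : ℝ) - 1))) ∧ |e - c.re| ≤ 2 := by
    rcases le_total 0 c.re with hc | hc
    · refine ⟨_, Or.inr rfl, ?_⟩
      rw [abs_of_nonneg hc] at hlog
      rwa [← abs_neg, neg_sub, sub_neg_eq_add, add_comm]
    · refine ⟨_, Or.inl rfl, ?_⟩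
      rwa [abs_of_nonpos hc] at hlog
  refine ⟨(e : ℂ) + 2 * m * Real.pi * Complex.I, ⟨n, m, by exact_mod_cast hn1, ?_⟩, ?_⟩
  · rcases he.1 with h | h <;> simp [h]
  · refine (Complex.norm_le_abs_re_add_abs_im _).trans ?_
    have hre : ((e : ℂ) + 2 * m * Real.pi * Complex.I - c).re = e - c.re := by simp
    have him' : ((e : ℂ) + 2 * m * Real.pi * Complex.I - c).im = 2 * m * Real.pi - c.im := by
      simp
    rw [hre, him']
    linarith [he.2]

theorem bddAbove_discGap_set :
    BddAbove {r : ℝ | ∃ c : ℂ, Disjoint (Metric.ball c r) exceptionalSet} := by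
  refine ⟨6, fun r ⟨c, hc⟩ => ?_⟩
  obtain ⟨e, he, hec⟩ := exists_mem_exceptionalSet_norm_sub_le c
  by_contra! hr
  exact Set.disjoint_left.1 hc (mem_ball_iff_norm.2 (hec.trans_lt hr)) he

theorem le_discGap {c : ℂ} {r : ℝ} (h : Disjoint (Metric.ball c r) exceptionalSet) :
    r ≤ discGap :=
  le_csSup bddAbove_discGap_set ⟨c, h⟩

theorem discGap_nonneg : 0 ≤ discGap := le_discGap (c := 0) (by simp)

/-! ### Growth of a function omitting the exceptional set -/

/-- A holomorphic function on a disc that omits the exceptional set has derivative at most `d / B`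
times the inverse distance to the boundary. -/
theorem norm_deriv_mul_le_discGap_div_blochConstant {F : ℂ → ℂ} {R : ℝ}
    (hF : DifferentiableOn ℂ F (Metric.ball 0 R))
    (hE : ∀ z ∈ Metric.ball (0 : ℂ) R, F z ∉ exceptionalSet) {z : ℂ}
    (hz : z ∈ Metric.ball (0 : ℂ) R) :
    ‖deriv F z‖ * (R - ‖z‖) ≤ discGap / blochConstant := by
  have hB := blochConstant_pos
  rcases eq_or_ne (deriv F z) 0 with h0 | h0
  · simpa [h0] using div_nonneg discGap_nonneg hB.le
  obtain ⟨t, ht⟩ : ∃ t, t = R - ‖z‖ := ⟨_, rfl⟩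
  have ht0 : 0 < t := by
    rw [mem_ball_zero_iff] at hz
    linarith
  have hmaps : ∀ ζ ∈ Metric.ball (0 : ℂ) 1, z + t * ζ ∈ Metric.ball (0 : ℂ) R := by
    intro ζ hζ
    rw [mem_ball_zero_iff] at hζ ⊢
    refine (norm_add_le _ _).trans_lt ?_
    rw [norm_mul, Complex.norm_of_nonneg ht0.le]
    nlinarith
  obtain ⟨κ, hκ⟩ : ∃ κ, κ = deriv F z * t := ⟨_, rfl⟩
  have ht' : (t : ℂ) ≠ 0 := by exact_mod_cast ht0.ne'
  have hκ0 : κ ≠ 0 := hκ ▸ mul_ne_zero h0 ht'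
  have hκn : ‖κ‖ = ‖deriv F z‖ * t := by rw [hκ, norm_mul, Complex.norm_of_nonneg ht0.le]
  have hκpos : 0 < ‖κ‖ := norm_pos_iff.2 hκ0
  rw [← ht, ← hκn, le_div_iff₀ hB, mul_comm, ← le_div_iff₀ hκpos]
  -- The supremum `B` need not be attained, so each admissible `b` is treated: `ζ ↦ F (z + t ζ) / κ`
  -- has derivative `1` at `0` and covers a disc of radius `b`, so `F` covers one of radius `b ‖κ‖`,
  -- which avoids the exceptional set.
  refine csSup_le ⟨1 / 96, fun _ hg h1 => bloch_theorem hg h1⟩ fun b hb => ?_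
  have hderiv : ∀ ζ ∈ Metric.ball (0 : ℂ) 1,
      HasDerivAt (fun ζ => F (z + t * ζ) / κ) (deriv F (z + t * ζ) * t / κ) ζ := by
    intro ζ hζ
    have h1 := (hF.differentiableAt (Metric.isOpen_ball.mem_nhds (hmaps ζ hζ))).hasDerivAt
    have h2 : HasDerivAt (fun ζ : ℂ => z + t * ζ) t ζ := by
      simpa using ((hasDerivAt_id ζ).const_mul (t : ℂ)).const_add z
    exact (h1.comp ζ h2).div_const κ
  obtain ⟨c, U, -, hU, hbij⟩ := hb (fun ζ => F (z + t * ζ) / κ)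
    (fun ζ hζ => (hderiv ζ hζ).differentiableAt.differentiableWithinAt) (by
      rw [(hderiv 0 (by simp)).deriv, mul_zero, add_zero, ← hκ, div_self hκ0])
  rw [le_div_iff₀ hκpos]
  refine le_discGap (c := κ * c) (Set.disjoint_left.2 fun w hw hwE => ?_)
  obtain ⟨ζ, hζ, hζw⟩ := hbij.surjOn (a := w / κ) (by
    rw [mem_ball_iff_norm] at hw ⊢
    have : w / κ - c = (w - κ * c) / κ := by field_simp
    rwa [this, norm_div, div_lt_iff₀ hκpos])
  have hFw : F (z + t * ζ) = w := by
    have := congrArg (· * κ) hζw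
    simpa [hκ0] using this
  exact hE _ (hmaps ζ (hU hζ)) (hFw ▸ hwE)

/-- Integrating the bound `‖F'(z)‖ ≤ K / (R - ‖z‖)` along a radius. -/
theorem norm_sub_le_mul_log_of_norm_deriv_mul_le {F : ℂ → ℂ} {R K : ℝ}
    (hF : DifferentiableOn ℂ F (Metric.ball 0 R))
    (hK : ∀ z ∈ Metric.ball (0 : ℂ) R, ‖deriv F z‖ * (R - ‖z‖) ≤ K) {z : ℂ}
    (hz : z ∈ Metric.ball (0 : ℂ) R) :
    ‖F z - F 0‖ ≤ K * Real.log (R / (R - ‖z‖)) := by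
  rw [mem_ball_zero_iff] at hz
  have hnorm : ∀ x ∈ Set.Icc (0 : ℝ) 1, x * ‖z‖ ≤ ‖z‖ := fun x hx =>
    mul_le_of_le_one_left (norm_nonneg z) hx.2
  have hnorm' : ∀ x ∈ Set.Icc (0 : ℝ) 1, ‖(x : ℂ) * z‖ = x * ‖z‖ := fun x hx => by
    rw [norm_mul, Complex.norm_of_nonneg hx.1]
  have hmem : ∀ x ∈ Set.Icc (0 : ℝ) 1, (x : ℂ) * z ∈ Metric.ball (0 : ℂ) R := fun x hx => by
    rw [mem_ball_zero_iff, hnorm' x hx]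
    exact (hnorm x hx).trans_lt hz
  have hder : ∀ x ∈ Set.Icc (0 : ℝ) 1,
      HasDerivAt (fun x : ℝ => F (x * z) - F 0) (deriv F (x * z) * z) x := by
    intro x hx
    have h1 := (hF.differentiableAt (Metric.isOpen_ball.mem_nhds (hmem x hx))).hasDerivAt
    have h2 : HasDerivAt (fun x : ℂ => x * z) z (x : ℂ) := by
      simpa using (hasDerivAt_id (x : ℂ)).mul_const z
    exact ((h1.comp (x : ℂ) h2).comp_ofReal).sub_const _
  -- The comparison function is the primitive, vanishing at `0`, of the bound on the speed of `x ↦ F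
  -- (x z)`.
  have hder' : ∀ x ∈ Set.Icc (0 : ℝ) 1,
      HasDerivAt (fun x : ℝ => K * (Real.log R - Real.log (R - x * ‖z‖)))
        (K * (‖z‖ / (R - x * ‖z‖))) x := by
    intro x hx
    have h0 : R - x * ‖z‖ ≠ 0 := by linarith [hnorm x hx]
    have h1 : HasDerivAt (fun x : ℝ => R - x * ‖z‖) (-‖z‖) x := by
      simpa using ((hasDerivAt_id x).mul_const ‖z‖).const_sub R
    exact (((h1.log h0).const_sub (Real.log R)).const_mul K).congr_deriv (by ring)
  have := image_norm_le_of_norm_deriv_right_le_deriv_boundary'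
    (fun x hx => (hder x hx).continuousAt.continuousWithinAt)
    (fun x hx => (hder x (Set.Ico_subset_Icc_self hx)).hasDerivWithinAt)
    (by simp)
    (fun x hx => (hder' x hx).continuousAt.continuousWithinAt)
    (fun x hx => (hder' x (Set.Ico_subset_Icc_self hx)).hasDerivWithinAt)
    (fun x hx => by
      have hx' := Set.Ico_subset_Icc_self hx
      have h0 : 0 < R - x * ‖z‖ := by linarith [hnorm x hx']
      have h1 := hK _ (hmem x hx')
      rw [hnorm' x hx', ← le_div_iff₀ h0] at h1
      rw [norm_mul]
      calc ‖deriv F (x * z)‖ * ‖z‖ ≤ K / (R - x * ‖z‖) * ‖z‖ := by gcongr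
        _ = K * (‖z‖ / (R - x * ‖z‖)) := by ring)
    (Set.right_mem_Icc.2 zero_le_one)
  rw [Real.log_div (by linarith [norm_nonneg z]) (by linarith)]
  simpa using this

/-! ### From `F` back to the size of `f` -/

/-- With `k = cos (x + iy)` and `v = sin (x + iy)` this is `|sin x sinh y| ≤ |sin x| cosh y`. The
proof is algebraic: in `h1` the assumption `k.im ^ 2 > v.re ^ 2` makes the left side positive and
the right side nonpositive. -/
theorem abs_im_le_abs_re_of_sq_eq_one_sub_sq {k v : ℂ} (h : k ^ 2 = 1 - v ^ 2) :
    |k.im| ≤ |v.re| := by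
  have hre : k.re ^ 2 - k.im ^ 2 = 1 - (v.re ^ 2 - v.im ^ 2) := by
    have := congrArg Complex.re h
    simp only [sq, Complex.mul_re, Complex.sub_re, Complex.one_re] at this
    linarith
  have him : k.re * k.im = -(v.re * v.im) := by
    have := congrArg Complex.im h
    simp only [sq, Complex.mul_im, Complex.sub_im, Complex.one_im] at this
    linarith
  refine sq_le_sq.1 ?_
  by_contra! hlt
  have h1 : k.im ^ 2 * (1 - v.re ^ 2 + k.im ^ 2) = (v.re ^ 2 - k.im ^ 2) * v.im ^ 2 := by
    linear_combination (k.re * k.im - v.re * v.im) * him - k.im ^ 2 * hre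
  nlinarith [sq_nonneg v.re, mul_nonneg (sub_nonneg.2 hlt.le) (sq_nonneg v.im)]

theorem abs_re_exp_sub_one_le (w : ℂ) : |(Complex.exp w).re - 1| ≤ Real.exp ‖w‖ := by
  have hx : w.re ≤ ‖w‖ := Complex.re_le_norm w
  have hex : Real.exp w.re ≤ Real.exp ‖w‖ := Real.exp_le_exp.2 hx
  have hpos := Real.exp_pos w.re
  have hone : 1 ≤ Real.exp ‖w‖ := Real.one_le_exp (norm_nonneg w)
  rw [Complex.exp_re, abs_le]
  refine ⟨?_, by nlinarith [Real.cos_le_one w.im]⟩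
  rcases le_or_gt 0 (Real.cos w.im) with hcos | hcos
  · nlinarith
  have hy : 3 / 2 ≤ |w.im| := by
    by_contra! hlt
    rw [abs_lt] at hlt
    have := Real.cos_nonneg_of_mem_Icc (x := w.im)
      ⟨by linarith [Real.pi_gt_three], by linarith [Real.pi_gt_three]⟩
    linarith
  -- A negative cosine forces `|Im w| > π / 2`, so `‖w‖` exceeds `Re w` by enough to absorb the
  -- extra `1`.
  suffices h : 1 + Real.exp w.re ≤ Real.exp ‖w‖ by nlinarith [Real.neg_one_le_cos w.im]
  rcases le_or_gt w.re 0 with hre | hre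
  · have h1 := Real.add_one_le_exp ‖w‖
    have h2 := Complex.abs_im_le_norm w
    have h3 := Real.exp_le_one_iff.2 hre
    linarith
  obtain ⟨δ, hδ⟩ : ∃ δ, δ = ‖w‖ - w.re := ⟨_, rfl⟩
  have hδ0 : 0 ≤ δ := by linarith
  have hw : ‖w‖ = w.re + δ := by linarith
  have hsq : ‖w‖ ^ 2 = w.re ^ 2 + w.im ^ 2 := by
    rw [Complex.sq_norm, Complex.normSq_apply]
    ring
  have him : 9 / 4 ≤ w.im ^ 2 := by
    rw [← sq_abs]
    nlinarith
  -- From `2 (Re w) δ + δ ^ 2 = (Im w) ^ 2 ≥ 9 / 4`. It gives `e^{Re w} (e^δ - 1) ≥ (Re w + 1) δ ≥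
  -- 1`.
  have hδ1 : 1 ≤ (w.re + 1) * δ := by
    rcases le_total 1 δ with h | h
    · nlinarith
    · rw [hw] at hsq
      nlinarith
  have h1 := Real.add_one_le_exp w.re
  have h2 := Real.add_one_le_exp δ
  rw [hw, Real.exp_add]
  nlinarith

theorem norm_le_exp_of_two_mul_abs_im_le {ℓ a : ℂ} {M : ℝ} (hℓ : Complex.exp ℓ = a)
    (hM : 2 * |(ℓ / (2 * Real.pi * Complex.I)).im| ≤ M) : ‖a‖ ≤ Real.exp (Real.pi * M) := by
  obtain ⟨h, hh⟩ : ∃ h, h = ℓ / (2 * Real.pi * Complex.I) := ⟨_, rfl⟩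
  have hpi := Real.pi_pos
  have hℓh : ℓ = 2 * Real.pi * Complex.I * h := by
    rw [hh, mul_div_cancel₀ _ Complex.two_pi_I_ne_zero]
  rw [← hh] at hM
  rw [← hℓ, Complex.norm_exp, Real.exp_le_exp, hℓh]
  have : (2 * Real.pi * Complex.I * h).re = -(2 * Real.pi * h.im) := by simp
  rw [this]
  nlinarith [neg_abs_le h.im]

theorem IsSchottkyValue.norm_le {a w : ℂ} (h : IsSchottkyValue a w) :
    ‖a‖ ≤ Real.exp (Real.pi * Real.exp (2 * ‖w‖)) := by
  obtain ⟨ℓ, s, hℓ, hs, hw⟩ := h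
  refine norm_le_exp_of_two_mul_abs_im_le hℓ ?_
  generalize ℓ / (2 * Real.pi * Complex.I) = h at hs
  have h1 : |(1 - 2 * h).im| ≤ |(2 * s).re| := abs_im_le_abs_re_of_sq_eq_one_sub_sq (by
    linear_combination 4 * hs)
  have h2 : |(2 * s).re| ≤ Real.exp ‖2 * w‖ := by
    have := abs_re_exp_sub_one_le (2 * w)
    rwa [hw, Complex.add_re, Complex.one_re, add_sub_cancel_left] at this
  have h3 : (1 - 2 * h).im = -(2 * h.im) := by simp
  rw [h3, abs_neg, abs_mul, abs_two] at h1
  rw [norm_mul, Complex.norm_two] at h2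
  exact h1.trans h2

/-- The conjugate `2h - 1 - 2s` is the inverse of `2h - 1 + 2s`, because `(2h - 1)² - 4h(h - 1) =
1`. -/
theorem Complex.cosh_eq_of_exp_eq_add_two_mul_sqrt {h s u : ℂ} (hs : s ^ 2 = h * (h - 1))
    (hu : Complex.exp u = 2 * h - 1 + 2 * s) : Complex.cosh u = 2 * h - 1 := by
  have hinv : Complex.exp (-u) = 2 * h - 1 - 2 * s := by
    rw [Complex.exp_neg, hu]
    refine inv_eq_of_mul_eq_one_right ?_
    linear_combination -4 * hs
  rw [Complex.cosh, hu, hinv]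
  ring

theorem Complex.norm_cosh_le_exp_norm (u : ℂ) : ‖Complex.cosh u‖ ≤ Real.exp ‖u‖ := by
  have h1 := Complex.norm_exp_le_exp_norm u
  have h2 := Complex.norm_exp_le_exp_norm (-u)
  rw [norm_neg] at h2
  rw [Complex.cosh, norm_div, Complex.norm_two]
  linarith [norm_add_le (Complex.exp u) (Complex.exp (-u))]

/-! ### Omitted values and existence of the branches -/

/-- The numbers `√n ∓ √(n - 1)` are mutually inverse and their squares have mean `2n - 1`. -/
theorem exists_cosh_two_mul_eq_of_mem_exceptionalSet {w : ℂ} (hw : w ∈ exceptionalSet) :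
    ∃ n : ℕ, Complex.cosh (2 * w) = 2 * n - 1 := by
  obtain ⟨n, m, hn, hw⟩ := hw
  refine ⟨n, ?_⟩
  have hn1 : (1 : ℝ) ≤ n := by exact_mod_cast hn
  have h1 := Real.sq_sqrt (by linarith : (0 : ℝ) ≤ n)
  have h2 := Real.sq_sqrt (by linarith : (0 : ℝ) ≤ (n : ℝ) - 1)
  have hlt : √((n : ℝ) - 1) < √(n : ℝ) := Real.sqrt_lt_sqrt (by linarith) (by linarith)
  have hq0 : 0 < √(n : ℝ) - √((n : ℝ) - 1) := by linarith
  have hinv : (√(n : ℝ) - √((n : ℝ) - 1))⁻¹ = √(n : ℝ) + √((n : ℝ) - 1) := by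
    refine inv_eq_of_mul_eq_one_right ?_
    linear_combination h1 - h2
  have hcosh : Real.cosh (2 * Real.log (√(n : ℝ) - √((n : ℝ) - 1))) = 2 * n - 1 := by
    have e : Real.exp (2 * Real.log (√(n : ℝ) - √((n : ℝ) - 1)))
        = (√(n : ℝ) - √((n : ℝ) - 1)) ^ 2 := by
      rw [two_mul, Real.exp_add, Real.exp_log hq0, sq]
    rw [Real.cosh_eq, Real.exp_neg, e, ← inv_pow, hinv]
    linear_combination h1 + h2
  have hcosh' : Complex.cosh (2 * (Real.log (√(n : ℝ) - √((n : ℝ) - 1)) : ℝ)) = 2 * n - 1 := by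
    exact_mod_cast congrArg ((↑) : ℝ → ℂ) hcosh
  have hper : ∀ x : ℂ, Complex.cosh (2 * (x + 2 * m * Real.pi * Complex.I))
      = Complex.cosh (2 * x) := by
    intro x
    have e1 : Complex.exp (2 * (x + 2 * m * Real.pi * Complex.I)) = Complex.exp (2 * x) := by
      rw [Complex.exp_eq_exp_iff_exists_int]
      exact ⟨2 * m, by push_cast; ring⟩
    rw [Complex.cosh, Complex.cosh, Complex.exp_neg, Complex.exp_neg, e1]
  rcases hw with rfl | rfl
  · rw [hper, hcosh']
  · rw [hper, mul_neg, Complex.cosh_neg, hcosh']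

theorem IsSchottkyFunction.norm_le {f F : ℂ → ℂ} {R : ℝ} (hF : IsSchottkyFunction f R F) {z : ℂ}
    (hz : z ∈ Metric.ball (0 : ℂ) R) : ‖f z‖ ≤ Real.exp (Real.pi * Real.exp (2 * ‖F z‖)) := by
  obtain ⟨ℓ, s, -, -, -, h⟩ := hF
  obtain ⟨hℓ, hs, hw⟩ := h z hz
  refine norm_le_exp_of_two_mul_abs_im_le hℓ ?_
  have hcosh := Complex.cosh_eq_of_exp_eq_add_two_mul_sqrt hs hw
  generalize ℓ z / (2 * Real.pi * Complex.I) = h at hcosh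
  have h1 := Complex.norm_cosh_le_exp_norm (2 * F z)
  have h2 := Complex.abs_im_le_norm (2 * h - 1)
  have h3 : (2 * h - 1).im = 2 * h.im := by simp
  rw [h3, abs_mul, abs_two] at h2
  rw [hcosh, norm_mul, Complex.norm_two] at h1
  exact h2.trans h1

theorem IsSchottkyFunction.notMem_exceptionalSet {f F : ℂ → ℂ} {R : ℝ}
    (hF : IsSchottkyFunction f R F) (h1 : ∀ z ∈ Metric.ball (0 : ℂ) R, f z ≠ 1) {z : ℂ}
    (hz : z ∈ Metric.ball (0 : ℂ) R) : F z ∉ exceptionalSet := by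
  obtain ⟨ℓ, s, -, -, -, h⟩ := hF
  obtain ⟨hℓ, hs, hw⟩ := h z hz
  intro hE
  obtain ⟨n, hn⟩ := exists_cosh_two_mul_eq_of_mem_exceptionalSet hE
  rw [Complex.cosh_eq_of_exp_eq_add_two_mul_sqrt hs hw] at hn
  have hh : ℓ z / (2 * Real.pi * Complex.I) = n := by linear_combination hn / 2
  rw [div_eq_iff Complex.two_pi_I_ne_zero] at hh
  exact h1 z hz (by rw [← hℓ, hh, Complex.exp_nat_mul_two_pi_mul_I])

theorem exists_isSchottkyFunction {f : ℂ → ℂ} {R : ℝ}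
    (hf : DifferentiableOn ℂ f (Metric.ball 0 R)) (h0 : ∀ z ∈ Metric.ball (0 : ℂ) R, f z ≠ 0)
    (h1 : ∀ z ∈ Metric.ball (0 : ℂ) R, f z ≠ 1) : ∃ F : ℂ → ℂ, IsSchottkyFunction f R F := by
  obtain ⟨ℓ, hℓd, hℓ⟩ := exists_holomorphic_log hf h0
  obtain ⟨h, hh⟩ : ∃ h : ℂ → ℂ, h = fun z => ℓ z / (2 * Real.pi * Complex.I) := ⟨_, rfl⟩
  have hhd : DifferentiableOn ℂ h (Metric.ball 0 R) := hh ▸ hℓd.div_const _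
  have hint : ∀ z ∈ Metric.ball (0 : ℂ) R, ∀ n : ℕ, h z ≠ n := by
    intro z hz n hn
    simp only [hh] at hn
    rw [div_eq_iff Complex.two_pi_I_ne_zero] at hn
    exact h1 z hz (by rw [← hℓ z hz, hn, Complex.exp_nat_mul_two_pi_mul_I])
  -- As `f ≠ 1`, `h` omits `0` and `1`, so `h (h - 1)` has a logarithm and hence a square root.
  obtain ⟨q, hqd, hq⟩ := exists_holomorphic_log (hhd.mul (hhd.sub_const 1)) fun z hz =>
    mul_ne_zero (by simpa using hint z hz 0) (sub_ne_zero.2 (by simpa using hint z hz 1))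
  have hs : ∀ z ∈ Metric.ball (0 : ℂ) R, Complex.exp (q z / 2) ^ 2 = h z * (h z - 1) := by
    intro z hz
    rw [← Complex.exp_nat_mul, Nat.cast_ofNat, mul_div_cancel₀ _ two_ne_zero]
    exact hq z hz
  have hsd : DifferentiableOn ℂ (fun z => Complex.exp (q z / 2)) (Metric.ball 0 R) :=
    (hqd.div_const 2).cexp
  obtain ⟨G, hGd, hG⟩ := exists_holomorphic_log
    (((hhd.const_mul 2).sub_const 1).add (hsd.const_mul 2)) fun z hz hzero => by
      have h2 := hs z hz
      simp only [Pi.add_apply] at hzero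
      -- Multiplying by the conjugate `2h - 1 - 2s` gives `1`, so the argument of the outer
      -- logarithm cannot vanish.
      have : (1 : ℂ) = 0 := by
        linear_combination (2 * h z - 1 - 2 * Complex.exp (q z / 2)) * hzero + 4 * h2
      exact one_ne_zero this
  refine ⟨fun z => G z / 2, ℓ, fun z => Complex.exp (q z / 2), hℓd, hsd, hGd.div_const 2,
    fun z hz => ⟨hℓ z hz, ?_, ?_⟩⟩
  · rw [hs z hz, hh]
  · rw [mul_div_cancel₀ _ two_ne_zero, hG z hz, hh]
    rfl

theorem theorem2 (R θ : ℝ) (hR : 0 < R) (hθ : θ ∈ Set.Ioo (0 : ℝ) 1) (f : ℂ → ℂ)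
    (hf : DifferentiableOn ℂ f (Metric.ball 0 R))
    (h0 : ∀ z ∈ Metric.ball (0 : ℂ) R, f z ≠ 0)
    (h1 : ∀ z ∈ Metric.ball (0 : ℂ) R, f z ≠ 1) :
    (∀ z : ℂ, ‖z‖ ≤ θ * R → ∀ w : ℂ, IsSchottkyValue (f z) w →
      ‖f z‖ ≤ Real.exp (Real.pi * Real.exp (2 * ‖w‖))) ∧
    (∃ F : ℂ → ℂ, IsSchottkyFunction f R F) ∧
    (∀ F : ℂ → ℂ, IsSchottkyFunction f R F → ∀ z : ℂ, ‖z‖ ≤ θ * R →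
      ‖f z‖ ≤ Real.exp (Real.pi * Real.exp (2 * ‖F z‖)) ∧
      ‖F z‖ ≤ ‖F 0‖ + discGap / blochConstant * Real.log (1 / (1 - θ))) := by
  obtain ⟨hθ0, hθ1⟩ := hθ
  have hmem : ∀ z : ℂ, ‖z‖ ≤ θ * R → z ∈ Metric.ball (0 : ℂ) R := fun z hz => by
    rw [mem_ball_zero_iff]
    nlinarith
  refine ⟨fun z _ w hw => hw.norm_le, exists_isSchottkyFunction hf h0 h1, fun F hF z hz =>
    ⟨hF.norm_le (hmem z hz), ?_⟩⟩
  have hFd : DifferentiableOn ℂ F (Metric.ball 0 R) := by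
    obtain ⟨_, _, _, _, hFd, _⟩ := hF
    exact hFd
  have hsub := norm_sub_le_mul_log_of_norm_deriv_mul_le hFd
    (fun x hx => norm_deriv_mul_le_discGap_div_blochConstant hFd
      (fun y hy => hF.notMem_exceptionalSet h1 hy) hx) (hmem z hz)
  have hR0 : 0 < R - ‖z‖ := by nlinarith
  have hlog : Real.log (R / (R - ‖z‖)) ≤ Real.log (1 / (1 - θ)) := by
    refine Real.log_le_log (by positivity) ?_
    rw [div_le_div_iff₀ hR0 (by linarith)]
    linarith
  have hK := mul_le_mul_of_nonneg_left hlog (div_nonneg discGap_nonneg blochConstant_pos.le)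
  linarith [norm_le_norm_add_norm_sub' (F z) (F 0)]
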